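/- Let $\mathcal G$ be a set, let $\mathbb F$ be the free non-unital complex $^*$-algebra generated by $\mathcal G$, and let $\mathcal R\subset\mathbb F$ be a set of $^*$-algebraic relations $r=0$, $r\in\mathcal R$. A representation $\pi$ of $(\mathcal G,\mathcal R)$ is a family $\{\pi(g)\}_{g\in\mathcal G}$ of bounded operators on a Hilbert space $H$ satisfying the relations; it extends uniquely to a $^*$-homomorphism $\pi:\mathbb F\to L(H)$, and $C^*(\pi)$ denotes the $C^*$-algebra generated by the operators $\pi(g)$. The representation is called faithful if $\pi(g)\neq 0$ for all $g\in\mathcal G$. Assume that $(\mathcal G,\mathcal R)$ is non-degenerate (it has a faithful representation) and admissible, that is, $$|||w|||:=\sup\{\|\pi(w)\|:\ \pi\text{ a representation of }(\mathcal G,\mathcal R)\}<\infty\qquad\text{for all } w\in\mathbb F.$$ Let $\mathbb I=\{w\in\mathbb F: |||w|||=0\}$ and let $C^*(\mathcal G,\mathcal R)$ be the completion of $\mathbb F/\mathbb I$ in the norm induced by $|||\cdot|||$; every representation $\pi$ of $(\mathcal G,\mathcal R)$ extends to a representation of $C^*(\mathcal G,\mathcal R)$, also denoted by $\pi$. For $t\in\mathbb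 T^{\mathcal G}$ let $\gamma_t$ be the $^*$-automorphism of $\mathbb F$ with $\gamma_t(g)=t_g\,g$ for $g\in\mathcal G$. Let $K\subset\mathbb T^{\mathcal G}$ be a closed subgroup such that $\gamma_t(\mathbb I)\subset\mathbb I$ for all $t\in K$, and let $\theta:\mathbb T\to K$ be an isomorphism of topological groups. Write $\gamma_z:=\gamma_{\theta(z)}$ for $z\in\mathbb T$, both on $\mathbb F$ and for the induced gauge action on $C^*(\mathcal G,\mathcal R)$, and let $\mathcal B_0=\{b\in C^*(\mathcal G,\mathcal R): \gamma_z(b)=b\text{ for all }z\in\mathbb T\}$ be the fixed-point algebra. A circle action on a $C^*$-algebra $A$ is a homomorphism $\beta$ from $\mathbb T$ to the group of $^*$-automorphisms of $A$ such that $z\mapsto\beta_z(a)$ is norm continuous for every $a\in A$. Then the following conditions are equivalent: (i) for each faithful representation $\pi$ of $(\mathcal G,\mathcal R)$, the extension of $\pi$ to $C^*(\mathcal G,\mathcal R)$ is injective on $\mathcal B_0$; (ii) for each faithful representation $\pi$ of $(\mathcal G,\mathcal R)$, the extension of $\pi$ to $C^*(\mathcal G,\mathcal R)$ is injective if and only if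 there is a circle action $\beta$ on $C^*(\pi)$ such that $$\beta_z(\pi(g))=\pi(\gamma_z(g)),\qquad g\in\mathcal G,\ z\in\mathbb T.$$ -/

import Mathlib

open scoped ENNReal

noncomputable section

namespace UniversalCStar

universe u

/-! ### The free non-unital `*`-algebra -/

/-- The involution on words in the letters `g` (that is, `Sum.inl g`) and `g⋆` (that is,
`Sum.inr g`): reverse the word and interchange `g` and `g⋆`. -/
def wordStar {G : Type u} (w : FreeSemigroup (G ⊕ G)) : FreeSemigroup (G ⊕ G) :=
  (FreeSemigroup.lift (fun s => MulOpposite.op (FreeSemigroup.of (Sum.swap s))) w).unop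

theorem wordStar_of {G : Type u} (s : G ⊕ G) :
    wordStar (FreeSemigroup.of s) = FreeSemigroup.of s.swap := rfl

theorem wordStar_mul {G : Type u} (v w : FreeSemigroup (G ⊕ G)) :
    wordStar (v * w) = wordStar w * wordStar v := by
  simp [wordStar]

theorem wordStar_wordStar {G : Type u} (w : FreeSemigroup (G ⊕ G)) :
    wordStar (wordStar w) = w := by
  induction w using FreeSemigroup.recOnMul with
  | ih1 x => simp [wordStar_of]
  | ih2 x y hx hy => rw [wordStar_mul, wordStar_mul, hx, hy]

/-- The free non-unital complex `*`-algebra on a set `G`: finite linear combinations of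
non-empty words in the letters `g`, `g⋆` with `g ∈ G`. -/
def FreeStarAlg (G : Type u) : Type u := MonoidAlgebra ℂ (FreeSemigroup (G ⊕ G))

namespace FreeStarAlg

variable {G : Type u}

instance : NonUnitalRing (FreeStarAlg G) :=
  inferInstanceAs (NonUnitalRing (MonoidAlgebra ℂ (FreeSemigroup (G ⊕ G))))

instance : Module ℂ (FreeStarAlg G) :=
  inferInstanceAs (Module ℂ (MonoidAlgebra ℂ (FreeSemigroup (G ⊕ G))))

instance : IsScalarTower ℂ (FreeStarAlg G) (FreeStarAlg G) :=
  inferInstanceAs (IsScalarTower ℂ (MonoidAlgebra ℂ (FreeSemigroup (G ⊕ G)))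
    (MonoidAlgebra ℂ (FreeSemigroup (G ⊕ G))))

instance : SMulCommClass ℂ (FreeStarAlg G) (FreeStarAlg G) :=
  inferInstanceAs (SMulCommClass ℂ (MonoidAlgebra ℂ (FreeSemigroup (G ⊕ G)))
    (MonoidAlgebra ℂ (FreeSemigroup (G ⊕ G))))

/-- The element `c • w` of the free `*`-algebra, for a word `w`. -/
def mono (w : FreeSemigroup (G ⊕ G)) (c : ℂ) : FreeStarAlg G := MonoidAlgebra.single w c

theorem mono_mul (v w : FreeSemigroup (G ⊕ G)) (a b : ℂ) :
    mono v a * mono w b = mono (v * w) (a * b) :=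
  MonoidAlgebra.single_mul_single v w a b

theorem smul_mono (w : FreeSemigroup (G ⊕ G)) (a b : ℂ) :
    a • mono w b = mono w (a * b) :=
  MonoidAlgebra.smul_single a w b

theorem induction_mono {p : FreeStarAlg G → Prop} (x : FreeStarAlg G) (zero : p 0)
    (add : ∀ x y, p x → p y → p (x + y)) (single : ∀ w c, p (mono w c)) : p x :=
  MonoidAlgebra.induction_linear x zero add single

/-- The involution as an additive map: `(∑ c_w w)⋆ = ∑ conj(c_w) w⋆`. -/
def starAdd : FreeStarAlg G →+ FreeStarAlg G :=
  (Finsupp.liftAddHom fun w : FreeSemigroup (G ⊕ G) =>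
    (MonoidAlgebra.singleAddHom (wordStar w)).comp
      (starRingEnd ℂ : ℂ →+* ℂ).toAddMonoidHom).comp
    (MonoidAlgebra.coeffAddEquiv (R := ℂ) (M := FreeSemigroup (G ⊕ G))).toAddMonoidHom

theorem starAdd_mono (w : FreeSemigroup (G ⊕ G)) (c : ℂ) :
    starAdd (mono w c) = mono (wordStar w) (star c) := by
  change (Finsupp.liftAddHom fun w : FreeSemigroup (G ⊕ G) =>
    (MonoidAlgebra.singleAddHom (wordStar w)).comp
      (starRingEnd ℂ : ℂ →+* ℂ).toAddMonoidHom) (Finsupp.single w c) = _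
  rw [Finsupp.liftAddHom_apply_single]
  rfl

instance : StarRing (FreeStarAlg G) where
  star := starAdd
  star_involutive x := by
    induction x using induction_mono with
    | zero => simp
    | add x y hx hy => rw [map_add, map_add, hx, hy]
    | single w c => rw [starAdd_mono, starAdd_mono, wordStar_wordStar, star_star]
  star_add := map_add starAdd
  star_mul x y := by
    induction x using induction_mono with
    | zero => simp
    | add x x' hx hx' => rw [add_mul, map_add, map_add, mul_add, hx, hx']
    | single v a =>
      induction y using induction_mono with
      | zero => simp
      | add y y' hy hy' => rw [mul_add, map_add, map_add, add_mul, hy, hy']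
      | single w b =>
        rw [mono_mul, starAdd_mono, starAdd_mono, starAdd_mono, mono_mul, wordStar_mul, star_mul]

theorem star_mono (w : FreeSemigroup (G ⊕ G)) (c : ℂ) :
    star (mono w c) = mono (wordStar w) (star c) := starAdd_mono w c

instance : StarModule ℂ (FreeStarAlg G) where
  star_smul a x := by
    induction x using induction_mono with
    | zero => simp
    | add x y hx hy => rw [smul_add, star_add, star_add, smul_add, hx, hy]
    | single w c => rw [smul_mono, star_mono, star_mono, smul_mono, star_mul, mul_comm]

/-- The generator of the free `*`-algebra corresponding to `g`. -/
def of (g : G) : FreeStarAlg G := mono (FreeSemigroup.of (Sum.inl g)) 1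

theorem induction_of {p : FreeStarAlg G → Prop} (x : FreeStarAlg G)
    (of : ∀ g, p (of g)) (star : ∀ x, p x → p (star x))
    (add : ∀ x y, p x → p y → p (x + y)) (mul : ∀ x y, p x → p y → p (x * y))
    (smul : ∀ (c : ℂ) x, p x → p (c • x)) (zero : p 0) : p x := by
  have key : ∀ w : FreeSemigroup (G ⊕ G), p (mono w 1) := by
    intro w
    induction w using FreeSemigroup.recOnMul with
    | ih1 s =>
      cases s with
      | inl g => exact of g
      | inr g => simpa [FreeStarAlg.of, star_mono, wordStar_of] using star _ (of g)
    | ih2 s w h1 h2 => simpa [mono_mul] using mul _ _ h1 h2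
  induction x using induction_mono with
  | zero => exact zero
  | add x y hx hy => exact add x y hx hy
  | single w c => simpa [smul_mono] using smul c _ (key w)

section lift

variable {A : Type*} [NonUnitalRing A] [Module ℂ A] [IsScalarTower ℂ A A] [SMulCommClass ℂ A A]
  [StarRing A] [StarModule ℂ A]

/-- The value of a word in the letters `g`, `g⋆` when `g` is replaced by `f g`. -/
def wordEval (f : G → A) : FreeSemigroup (G ⊕ G) →ₙ* A :=
  FreeSemigroup.lift (Sum.elim f fun g => star (f g))

set_option linter.unusedSectionVars false in
theorem wordEval_wordStar (f : G → A) (w : FreeSemigroup (G ⊕ G)) :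
    wordEval f (wordStar w) = star (wordEval f w) := by
  induction w using FreeSemigroup.recOnMul with
  | ih1 s => cases s <;> simp [wordStar_of, wordEval]
  | ih2 v w h1 h2 => rw [wordStar_mul, map_mul, map_mul, h1, h2, star_mul]

/-- The linear and multiplicative extension of `f : G → A` to the free `*`-algebra. -/
def liftAlg (f : G → A) : FreeStarAlg G →ₙₐ[ℂ] A :=
  MonoidAlgebra.liftMagma ℂ (wordEval f)

set_option linter.unusedSectionVars false in
theorem liftAlg_mono (f : G → A) (w : FreeSemigroup (G ⊕ G)) (c : ℂ) :
    liftAlg f (mono w c) = c • wordEval f w := by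
  change (Finsupp.liftAddHom fun w : FreeSemigroup (G ⊕ G) =>
    (smulAddHom ℂ A).flip (wordEval f w)) (Finsupp.single w c) = _
  rw [Finsupp.liftAddHom_apply_single]
  rfl

/-- The `*`-homomorphism from the free `*`-algebra on `G` that extends `f : G → A`. -/
def lift (f : G → A) : FreeStarAlg G →⋆ₙₐ[ℂ] A :=
  { liftAlg f with
    map_star' := fun x => by
      change liftAlg f (star x) = star (liftAlg f x)
      induction x using induction_mono with
      | zero => simp
      | add x y hx hy => rw [star_add, map_add, map_add, star_add, hx, hy]
      | single w c => rw [star_mono, liftAlg_mono, liftAlg_mono, wordEval_wordStar, star_smul] }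

theorem lift_of (f : G → A) (g : G) : lift f (of g) = f g := by
  change liftAlg f (mono _ 1) = _
  rw [liftAlg_mono, one_smul]
  rfl

set_option linter.unusedSectionVars false in
theorem hom_ext {φ ψ : FreeStarAlg G →⋆ₙₐ[ℂ] A} (h : ∀ g, φ (of g) = ψ (of g)) : φ = ψ := by
  ext x
  induction x using induction_of with
  | of g => exact h g
  | star x hx => rw [map_star, map_star, hx]
  | add x y hx hy => rw [map_add, map_add, hx, hy]
  | mul x y hx hy => rw [map_mul, map_mul, hx, hy]
  | smul c x hx => rw [map_smul, map_smul, hx]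
  | zero => rw [map_zero, map_zero]

end lift

end FreeStarAlg

/-! ### Completion of a `C*`-seminormed algebra -/

/-- The inequality that makes a seminorm on a `*`-algebra with isometric involution a
`C*`-seminorm. -/
class CStarSeminorm (A : Type*) [NonUnitalSeminormedRing A] [StarRing A] : Prop where
  norm_mul_self_le : ∀ a : A, ‖a‖ * ‖a‖ ≤ ‖star a * a‖

/-- The Hausdorff completion of a `*`-algebra `A` with a `C*`-seminorm, that is, the completion of
the quotient of `A` by the kernel of the seminorm. -/
def CStarCompletion (A : Type*) [NonUnitalSeminormedRing A] : Type _ :=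
  UniformSpace.Completion A

namespace CStarCompletion

variable {A : Type*} [NonUnitalSeminormedRing A]

instance : NormedAddCommGroup (CStarCompletion A) :=
  inferInstanceAs (NormedAddCommGroup (UniformSpace.Completion A))

instance [NormedSpace ℂ A] : NormedSpace ℂ (CStarCompletion A) :=
  inferInstanceAs (NormedSpace ℂ (UniformSpace.Completion A))

instance : CompleteSpace (CStarCompletion A) :=
  inferInstanceAs (CompleteSpace (UniformSpace.Completion A))

/-- The canonical additive map from `A` to its completion. -/
def mkAdd : A →+ CStarCompletion A := UniformSpace.Completion.toCompl

theorem norm_mkAdd (a : A) : ‖mkAdd a‖ = ‖a‖ := UniformSpace.Completion.norm_coe a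

theorem isDenseInducing_mkAdd : IsDenseInducing (mkAdd : A → CStarCompletion A) :=
  UniformSpace.Completion.isDenseInducing_coe

theorem continuous_mkAdd : Continuous (mkAdd : A → CStarCompletion A) :=
  isDenseInducing_mkAdd.continuous

theorem mkAdd_smul [NormedSpace ℂ A] (c : ℂ) (a : A) : mkAdd (c • a) = c • mkAdd a :=
  UniformSpace.Completion.coe_smul c a

theorem induction {p : CStarCompletion A → Prop} (a : CStarCompletion A)
    (hp : IsClosed {a | p a}) (ih : ∀ a : A, p (mkAdd a)) : p a :=
  UniformSpace.Completion.induction_on a hp ih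

theorem induction₂ {p : CStarCompletion A → CStarCompletion A → Prop} (a b : CStarCompletion A)
    (hp : IsClosed {x : CStarCompletion A × CStarCompletion A | p x.1 x.2})
    (ih : ∀ a b : A, p (mkAdd a) (mkAdd b)) : p a b :=
  UniformSpace.Completion.induction_on₂ a b hp ih

theorem induction₃ {p : CStarCompletion A → CStarCompletion A → CStarCompletion A → Prop}
    (a b c : CStarCompletion A)
    (hp : IsClosed {x : CStarCompletion A × CStarCompletion A × CStarCompletion A |
      p x.1 x.2.1 x.2.2})
    (ih : ∀ a b c : A, p (mkAdd a) (mkAdd b) (mkAdd c)) : p a b c :=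
  UniformSpace.Completion.induction_on₃ a b c hp ih

/-- Multiplication, extended by continuity. -/
instance : Mul (CStarCompletion A) :=
  ⟨fun a b => (isDenseInducing_mkAdd.prodMap isDenseInducing_mkAdd).extend
    (fun x : A × A => mkAdd (x.1 * x.2)) (a, b)⟩

/-- The involution, extended by continuity. -/
instance [StarRing A] : Star (CStarCompletion A) :=
  ⟨UniformSpace.Completion.map star⟩

theorem mkAdd_mul (a b : A) : mkAdd (a * b) = mkAdd a * mkAdd b :=
  ((isDenseInducing_mkAdd.prodMap isDenseInducing_mkAdd).extend_eq
    (f := fun x : A × A => mkAdd (x.1 * x.2))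
    (continuous_mkAdd.comp continuous_mul) (a, b)).symm

theorem mkAdd_star [StarRing A] [NormedStarGroup A] (a : A) : mkAdd (star a) = star (mkAdd a) :=
  (UniformSpace.Completion.map_coe (star_isometry (E := A)).uniformContinuous a).symm

instance : ContinuousMul (CStarCompletion A) where
  continuous_mul := by
    let m := (AddMonoidHom.mul : A →+ A →+ A).compr₂
      (UniformSpace.Completion.toCompl : A →+ UniformSpace.Completion A)
    have hm : Continuous fun p : A × A => m p.1 p.2 :=
      (UniformSpace.Completion.continuous_coe A).comp continuous_mul
    have di : IsDenseInducing (UniformSpace.Completion.toCompl : A → UniformSpace.Completion A) :=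
      UniformSpace.Completion.isDenseInducing_coe
    exact (di.extend_Z_bilin di hm :)

instance [StarRing A] : ContinuousStar (CStarCompletion A) where
  continuous_star := UniformSpace.Completion.continuous_map (f := (star : A → A))

instance : NonUnitalNormedRing (CStarCompletion A) where
  __ := (inferInstance : NormedAddCommGroup (CStarCompletion A))
  __ := (inferInstance : Mul (CStarCompletion A))
  zero_mul a := by
    induction a using induction with
    | hp => exact isClosed_eq (by fun_prop) (by fun_prop)
    | ih a => rw [← map_zero mkAdd, ← mkAdd_mul, zero_mul]
  mul_zero a := by
    induction a using induction with
    | hp => exact isClosed_eq (by fun_prop) (by fun_prop)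
    | ih a => rw [← map_zero mkAdd, ← mkAdd_mul, mul_zero]
  mul_assoc a b c := by
    induction a, b, c using induction₃ with
    | hp => exact isClosed_eq (by fun_prop) (by fun_prop)
    | ih a b c => simp only [← mkAdd_mul, mul_assoc]
  left_distrib a b c := by
    induction a, b, c using induction₃ with
    | hp => exact isClosed_eq (by fun_prop) (by fun_prop)
    | ih a b c => simp only [← mkAdd_mul, ← map_add, mul_add]
  right_distrib a b c := by
    induction a, b, c using induction₃ with
    | hp => exact isClosed_eq (by fun_prop) (by fun_prop)
    | ih a b c => simp only [← mkAdd_mul, ← map_add, add_mul]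
  norm_mul_le a b := by
    induction a, b using induction₂ with
    | hp => exact isClosed_le (by fun_prop) (by fun_prop)
    | ih a b =>
      rw [← mkAdd_mul, norm_mkAdd, norm_mkAdd, norm_mkAdd]
      exact norm_mul_le a b

instance [StarRing A] [NormedStarGroup A] : StarRing (CStarCompletion A) where
  star_involutive a := by
    induction a using induction with
    | hp => exact isClosed_eq (by fun_prop) (by fun_prop)
    | ih a => rw [← mkAdd_star, ← mkAdd_star, star_star]
  star_add a b := by
    induction a, b using induction₂ with
    | hp => exact isClosed_eq (by fun_prop) (by fun_prop)
    | ih a b => simp only [← map_add, ← mkAdd_star, star_add]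
  star_mul a b := by
    induction a, b using induction₂ with
    | hp => exact isClosed_eq (by fun_prop) (by fun_prop)
    | ih a b => simp only [← mkAdd_mul, ← mkAdd_star, star_mul]

instance [StarRing A] [NormedStarGroup A] [CStarSeminorm A] [NormedSpace ℂ A]
    [IsScalarTower ℂ A A] [SMulCommClass ℂ A A] [StarModule ℂ A] :
    NonUnitalCStarAlgebra (CStarCompletion A) where
  norm_mul_self_le a := by
    induction a using induction with
    | hp => exact isClosed_le (by fun_prop) (by fun_prop)
    | ih a =>
      rw [← mkAdd_star, ← mkAdd_mul, norm_mkAdd, norm_mkAdd]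
      exact CStarSeminorm.norm_mul_self_le a
  smul_assoc c a b := by
    induction a, b using induction₂ with
    | hp =>
      exact isClosed_eq ((continuous_fst.const_smul c).mul continuous_snd)
        ((continuous_fst.mul continuous_snd).const_smul c)
    | ih a b => simp only [smul_eq_mul, ← mkAdd_smul, ← mkAdd_mul, smul_mul_assoc]
  smul_comm c a b := by
    induction a, b using induction₂ with
    | hp =>
      exact isClosed_eq ((continuous_fst.mul continuous_snd).const_smul c)
        (continuous_fst.mul (continuous_snd.const_smul c))
    | ih a b => simp only [smul_eq_mul, ← mkAdd_smul, ← mkAdd_mul, mul_smul_comm]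
  star_smul c a := by
    induction a using induction with
    | hp => exact isClosed_eq (continuous_id.const_smul c).star (continuous_star.const_smul (star c))
    | ih a => simp only [← mkAdd_smul, ← mkAdd_star, star_smul]

end CStarCompletion

/-! ### Representations of generators and relations -/

variable {G : Type u}

/-- A representation of `(G, R)` on a Hilbert space: bounded operators `op g`, `g ∈ G`, that
satisfy the relations `r = 0` for all `r ∈ R`. -/
structure Rep (R : Set (FreeStarAlg G)) where
  H : Type u
  [normed : NormedAddCommGroup H]
  [inner : InnerProductSpace ℂ H]
  [complete : CompleteSpace H]
  op : G → H →L[ℂ] H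
  relations : ∀ r ∈ R, FreeStarAlg.lift op r = 0

attribute [instance] Rep.normed Rep.inner Rep.complete

namespace Rep

variable {R : Set (FreeStarAlg G)}

/-- The extension of a representation to a `*`-homomorphism of the free `*`-algebra. -/
def hom (π : Rep R) : FreeStarAlg G →⋆ₙₐ[ℂ] (π.H →L[ℂ] π.H) := FreeStarAlg.lift π.op

/-- A representation of `(G, R)` is faithful if no generator is sent to zero. -/
def IsFaithful (π : Rep R) : Prop := ∀ g, π.op g ≠ 0

/-- The `C*`-algebra `C*(π)` generated by the operators of a representation. -/
def cstar (π : Rep R) : NonUnitalStarSubalgebra ℂ (π.H →L[ℂ] π.H) :=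
  (NonUnitalStarAlgebra.adjoin ℂ (Set.range π.op)).topologicalClosure

theorem op_mem_cstar (π : Rep R) (g : G) : π.op g ∈ π.cstar :=
  NonUnitalStarSubalgebra.le_topologicalClosure _
    (NonUnitalStarAlgebra.subset_adjoin ℂ _ (Set.mem_range_self g))

/-- The operator of a generator, as an element of `C*(π)`. -/
def gen (π : Rep R) (g : G) : π.cstar := ⟨π.op g, π.op_mem_cstar g⟩

end Rep

/-- `(G, R)` is non-degenerate if it has a faithful representation. -/
def Nondegenerate (R : Set (FreeStarAlg G)) : Prop := ∃ π : Rep R, π.IsFaithful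

/-- `|||w|||`, the supremum of `‖π w‖` over all representations `π` of `(G, R)`. -/
def supNorm (R : Set (FreeStarAlg G)) (w : FreeStarAlg G) : ℝ≥0∞ := ⨆ π : Rep R, ‖π.hom w‖ₑ

/-- `(G, R)` is admissible if `|||·|||` is finite. -/
def Admissible (R : Set (FreeStarAlg G)) : Prop := ∀ w, supNorm R w < ∞

/-- The kernel of `|||·|||`. -/
def nullIdeal (R : Set (FreeStarAlg G)) : Set (FreeStarAlg G) := {w | supNorm R w = 0}

/-! ### The universal `C*`-algebra -/

/-- The free `*`-algebra, equipped with the seminorm `|||·|||` of an admissible pair `(G, R)`. -/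
def SeminormedFree (R : Set (FreeStarAlg G)) (_ : Admissible R) : Type u := FreeStarAlg G

section Seminormed

variable (R : Set (FreeStarAlg G)) (hR : Admissible R)

theorem enorm_hom_le (π : Rep R) (w : FreeStarAlg G) : ‖π.hom w‖ₑ ≤ supNorm R w :=
  le_iSup (fun π : Rep R => ‖π.hom w‖ₑ) π

theorem supNorm_zero : supNorm R 0 = 0 := by simp [supNorm]

theorem supNorm_add_le (v w : FreeStarAlg G) : supNorm R (v + w) ≤ supNorm R v + supNorm R w :=
  iSup_le fun π => by
    rw [map_add]
    exact (enorm_add_le _ _).trans (add_le_add (enorm_hom_le R π v) (enorm_hom_le R π w))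

theorem supNorm_neg (w : FreeStarAlg G) : supNorm R (-w) = supNorm R w := by
  simp [supNorm]

theorem supNorm_smul (c : ℂ) (w : FreeStarAlg G) : supNorm R (c • w) = ‖c‖ₑ * supNorm R w := by
  simp [supNorm, ENNReal.mul_iSup, enorm_smul]

theorem supNorm_mul_le (v w : FreeStarAlg G) : supNorm R (v * w) ≤ supNorm R v * supNorm R w :=
  iSup_le fun π => by
    rw [map_mul]
    refine le_trans ?_ (mul_le_mul' (enorm_hom_le R π v) (enorm_hom_le R π w))
    simp only [enorm_eq_nnnorm]
    exact_mod_cast nnnorm_mul_le _ _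

theorem supNorm_sq_le (w : FreeStarAlg G) :
    supNorm R w * supNorm R w ≤ supNorm R (star w * w) := by
  have h : supNorm R w ≤ (supNorm R (star w * w)) ^ (1 / 2 : ℝ) := by
    refine iSup_le fun π => ?_
    have h2 : ‖π.hom w‖ₑ ^ (2 : ℝ) ≤ supNorm R (star w * w) := by
      refine le_trans (le_of_eq ?_) (enorm_hom_le R π _)
      rw [map_mul, map_star, enorm_eq_nnnorm, enorm_eq_nnnorm, CStarRing.nnnorm_star_mul_self,
        ENNReal.rpow_two, sq, ENNReal.coe_mul]
    have h3 := ENNReal.rpow_le_rpow h2 (by norm_num : (0 : ℝ) ≤ 1 / 2)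
    rwa [← ENNReal.rpow_mul, mul_one_div_cancel two_ne_zero, ENNReal.rpow_one] at h3
  have h3 := ENNReal.rpow_le_rpow h (by norm_num : (0 : ℝ) ≤ 2)
  rwa [← ENNReal.rpow_mul, one_div_mul_cancel two_ne_zero, ENNReal.rpow_one, ENNReal.rpow_two,
    sq] at h3

instance : NonUnitalRing (SeminormedFree R hR) := inferInstanceAs (NonUnitalRing (FreeStarAlg G))

instance : Module ℂ (SeminormedFree R hR) := inferInstanceAs (Module ℂ (FreeStarAlg G))

instance : IsScalarTower ℂ (SeminormedFree R hR) (SeminormedFree R hR) :=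
  inferInstanceAs (IsScalarTower ℂ (FreeStarAlg G) (FreeStarAlg G))

instance : SMulCommClass ℂ (SeminormedFree R hR) (SeminormedFree R hR) :=
  inferInstanceAs (SMulCommClass ℂ (FreeStarAlg G) (FreeStarAlg G))

instance : StarRing (SeminormedFree R hR) := inferInstanceAs (StarRing (FreeStarAlg G))

instance : StarModule ℂ (SeminormedFree R hR) := inferInstanceAs (StarModule ℂ (FreeStarAlg G))

instance : NonUnitalSeminormedRing (SeminormedFree R hR) where
  __ := (inferInstance : NonUnitalRing (SeminormedFree R hR))
  __ := AddGroupSeminorm.toSeminormedAddCommGroup (E := SeminormedFree R hR)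
    { toFun := fun w => (supNorm R w).toReal
      map_zero' := by
        change (supNorm R (0 : FreeStarAlg G)).toReal = 0
        rw [supNorm_zero, ENNReal.toReal_zero]
      add_le' := fun v w => by
        rw [← ENNReal.toReal_add (hR v).ne (hR w).ne]
        exact ENNReal.toReal_mono (ENNReal.add_ne_top.2 ⟨(hR v).ne, (hR w).ne⟩)
          (supNorm_add_le R v w)
      neg' := fun w => congrArg ENNReal.toReal (supNorm_neg R w) }
  norm_mul_le v w := by
    change (supNorm R _).toReal ≤ (supNorm R v).toReal * (supNorm R w).toReal
    rw [← ENNReal.toReal_mul]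
    exact ENNReal.toReal_mono (ENNReal.mul_ne_top (hR v).ne (hR w).ne) (supNorm_mul_le R v w)

variable {R} in
theorem norm_def (w : SeminormedFree R hR) : ‖w‖ = (supNorm R w).toReal := rfl

instance : NormedSpace ℂ (SeminormedFree R hR) where
  norm_smul_le c w := by
    refine le_of_eq ?_
    have := congrArg ENNReal.toReal (supNorm_smul R c w)
    rwa [ENNReal.toReal_mul, toReal_enorm] at this

variable {R} in
theorem norm_hom_le (π : Rep R) (w : SeminormedFree R hR) : ‖π.hom w‖ ≤ ‖w‖ := by
  have := ENNReal.toReal_mono (hR w).ne (enorm_hom_le R π w)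
  rwa [toReal_enorm] at this

instance : NormedStarGroup (SeminormedFree R hR) where
  norm_star_le w := by
    refine ENNReal.toReal_mono (hR w).ne (iSup_le fun π => ?_)
    refine le_trans (le_of_eq ?_) (enorm_hom_le R π w)
    have : π.hom (star (show FreeStarAlg G from w)) = star (π.hom w) := map_star π.hom _
    change ‖π.hom (star (show FreeStarAlg G from w))‖ₑ = _
    rw [this, enorm_eq_nnnorm, enorm_eq_nnnorm, nnnorm_star]

instance : CStarSeminorm (SeminormedFree R hR) where
  norm_mul_self_le w := by
    simp only [norm_def]
    rw [← ENNReal.toReal_mul]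
    exact ENNReal.toReal_mono (hR _).ne (supNorm_sq_le R w)

end Seminormed

/-- The universal `C*`-algebra `C*(G, R)`: the completion of the quotient of the free `*`-algebra by
the kernel of `|||·|||`. -/
abbrev Univ (R : Set (FreeStarAlg G)) (hR : Admissible R) : Type u :=
  CStarCompletion (SeminormedFree R hR)

namespace Univ

variable {R : Set (FreeStarAlg G)} {hR : Admissible R}

variable (R hR) in
/-- The canonical `*`-homomorphism from the free `*`-algebra to `C*(G, R)`. -/
def mk : FreeStarAlg G →⋆ₙₐ[ℂ] Univ R hR where
  toFun w := CStarCompletion.mkAdd (A := SeminormedFree R hR) w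
  map_smul' := CStarCompletion.mkAdd_smul (A := SeminormedFree R hR)
  map_zero' := map_zero (CStarCompletion.mkAdd (A := SeminormedFree R hR))
  map_add' := map_add (CStarCompletion.mkAdd (A := SeminormedFree R hR))
  map_mul' := CStarCompletion.mkAdd_mul (A := SeminormedFree R hR)
  map_star' := CStarCompletion.mkAdd_star (A := SeminormedFree R hR)

theorem norm_mk (w : FreeStarAlg G) : ‖mk R hR w‖ = (supNorm R w).toReal :=
  CStarCompletion.norm_mkAdd (A := SeminormedFree R hR) w

theorem denseRange_mk : DenseRange (mk R hR) :=
  (CStarCompletion.isDenseInducing_mkAdd (A := SeminormedFree R hR)).dense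

theorem mk_eq_zero_iff (w : FreeStarAlg G) : mk R hR w = 0 ↔ w ∈ nullIdeal R := by
  rw [← norm_eq_zero, norm_mk, ENNReal.toReal_eq_zero_iff, or_iff_left (hR w).ne]
  rfl

theorem induction {p : Univ R hR → Prop} (a : Univ R hR) (hp : IsClosed {a | p a})
    (ih : ∀ w, p (mk R hR w)) : p a :=
  CStarCompletion.induction a hp ih

theorem induction₂ {p : Univ R hR → Univ R hR → Prop} (a b : Univ R hR)
    (hp : IsClosed {x : Univ R hR × Univ R hR | p x.1 x.2})
    (ih : ∀ v w, p (mk R hR v) (mk R hR w)) : p a b :=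
  CStarCompletion.induction₂ a b hp ih

section extension

variable {B : Type*} [NonUnitalCStarAlgebra B]

/-- The extension by continuity to `C*(G, R)` of a `*`-homomorphism of the free `*`-algebra, as a
function. -/
def extendFun (φ : FreeStarAlg G →⋆ₙₐ[ℂ] B) : Univ R hR → B :=
  UniformSpace.Completion.extension (α := SeminormedFree R hR) φ

theorem continuous_extendFun (φ : FreeStarAlg G →⋆ₙₐ[ℂ] B) :
    Continuous (extendFun (hR := hR) φ) :=
  UniformSpace.Completion.continuous_extension

theorem extendFun_mk (φ : FreeStarAlg G →⋆ₙₐ[ℂ] B) (hφ : ∀ w, ‖φ w‖ ≤ (supNorm R w).toReal)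
    (w : FreeStarAlg G) : extendFun (hR := hR) φ (mk R hR w) = φ w := by
  let φ' : SeminormedFree R hR →+ B :=
    { toFun := φ, map_zero' := map_zero φ, map_add' := map_add φ }
  have hc : UniformContinuous φ' :=
    (AddMonoidHomClass.lipschitz_of_bound φ' 1 fun w => by
      rw [one_mul]; exact hφ w).uniformContinuous
  exact UniformSpace.Completion.extension_coe hc w

/-- The extension by continuity to `C*(G, R)` of a `*`-homomorphism of the free `*`-algebra that
is contractive for `|||·|||`. -/
def extend (φ : FreeStarAlg G →⋆ₙₐ[ℂ] B) (hφ : ∀ w, ‖φ w‖ ≤ (supNorm R w).toReal) :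
    Univ R hR →⋆ₙₐ[ℂ] B where
  toFun := extendFun φ
  map_smul' c a := by
    have hc := continuous_extendFun (hR := hR) φ
    induction a using induction with
    | hp => exact isClosed_eq (hc.comp (continuous_id.const_smul c)) (hc.const_smul c)
    | ih w =>
      rw [MonoidHom.id_apply, ← map_smul, extendFun_mk φ hφ, extendFun_mk φ hφ, map_smul]
  map_zero' := by rw [← map_zero (mk R hR), extendFun_mk φ hφ, map_zero]
  map_add' a b := by
    have hc := continuous_extendFun (hR := hR) φ
    induction a, b using induction₂ with
    | hp => exact isClosed_eq (by fun_prop) (by fun_prop)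
    | ih v w =>
      rw [← map_add, extendFun_mk φ hφ, extendFun_mk φ hφ, extendFun_mk φ hφ, map_add]
  map_mul' a b := by
    have hc := continuous_extendFun (hR := hR) φ
    induction a, b using induction₂ with
    | hp => exact isClosed_eq (by fun_prop) (by fun_prop)
    | ih v w =>
      rw [← map_mul, extendFun_mk φ hφ, extendFun_mk φ hφ, extendFun_mk φ hφ, map_mul]
  map_star' a := by
    have hc := continuous_extendFun (hR := hR) φ
    induction a using induction with
    | hp => exact isClosed_eq (by fun_prop) (by fun_prop)
    | ih w => rw [← map_star, extendFun_mk φ hφ, extendFun_mk φ hφ, map_star]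

theorem continuous_extend (φ : FreeStarAlg G →⋆ₙₐ[ℂ] B)
    (hφ : ∀ w, ‖φ w‖ ≤ (supNorm R w).toReal) : Continuous (extend (hR := hR) φ hφ) :=
  continuous_extendFun φ

theorem extend_mk (φ : FreeStarAlg G →⋆ₙₐ[ℂ] B) (hφ : ∀ w, ‖φ w‖ ≤ (supNorm R w).toReal)
    (w : FreeStarAlg G) : extend (hR := hR) φ hφ (mk R hR w) = φ w :=
  extendFun_mk φ hφ w

end extension

end Univ

/-- The representation of `C*(G, R)` to which a representation of `(G, R)` extends. -/
def Rep.extend {R : Set (FreeStarAlg G)} (π : Rep R) (hR : Admissible R) :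
    Univ R hR →⋆ₙₐ[ℂ] (π.H →L[ℂ] π.H) :=
  Univ.extend π.hom fun w => norm_hom_le hR π w

theorem Rep.extend_mk {R : Set (FreeStarAlg G)} (π : Rep R) (hR : Admissible R)
    (w : FreeStarAlg G) : π.extend hR (Univ.mk R hR w) = π.hom w :=
  Univ.extend_mk _ _ w

/-! ### Circle actions and gauge actions -/

/-- A circle action on a (non-unital) `C*`-algebra: a homomorphism from the circle group to the
`*`-automorphisms such that all orbit maps are norm continuous. -/
structure CircleAction (A : Type*) [NonUnitalNormedRing A] [StarRing A] [Module ℂ A] where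
  aut : Circle →* (A ≃⋆ₐ[ℂ] A)
  continuous_orbit : ∀ a, Continuous fun z => aut z a

/-- The torus action on the free `*`-algebra, determined by `γ_t(g) = t_g g`. -/
def torus (t : G → Circle) : FreeStarAlg G →⋆ₙₐ[ℂ] FreeStarAlg G :=
  FreeStarAlg.lift fun g => (t g : ℂ) • FreeStarAlg.of g

theorem torus_one (w : FreeStarAlg G) : torus 1 w = w := by
  have : torus (1 : G → Circle) = NonUnitalStarAlgHom.id ℂ _ :=
    FreeStarAlg.hom_ext fun g => by simp [torus, FreeStarAlg.lift_of]
  rw [this]; rfl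

theorem torus_mul (s t : G → Circle) (w : FreeStarAlg G) :
    torus (s * t) w = torus s (torus t w) := by
  have : torus (s * t) = (torus s).comp (torus t) :=
    FreeStarAlg.hom_ext fun g => by
      simp [torus, FreeStarAlg.lift_of, smul_smul, mul_comm]
  rw [this]; rfl

/-- A closed subgroup of the torus `𝕋^G` that leaves the kernel of `|||·|||` invariant, together
with an isomorphism of topological groups from the circle onto it. -/
structure CircleSymmetry (R : Set (FreeStarAlg G)) where
  group : Subgroup (G → Circle)
  isClosed : IsClosed (group : Set (G → Circle))
  invariant : ∀ t ∈ group, ∀ w ∈ nullIdeal R, torus t w ∈ nullIdeal R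
  iso : Circle ≃ₜ* group

namespace CircleSymmetry

variable {R : Set (FreeStarAlg G)}

/-- The element of the torus `𝕋^G` given by a point of the circle. -/
def param (σ : CircleSymmetry R) (z : Circle) : G → Circle := σ.iso z

/-- The circle action on the free `*`-algebra. -/
def freeAct (σ : CircleSymmetry R) (z : Circle) : FreeStarAlg G →⋆ₙₐ[ℂ] FreeStarAlg G :=
  torus (σ.param z)

theorem freeAct_one (σ : CircleSymmetry R) (w : FreeStarAlg G) : σ.freeAct 1 w = w := by
  rw [freeAct, param, map_one]
  exact torus_one w

theorem freeAct_mul (σ : CircleSymmetry R) (y z : Circle) (w : FreeStarAlg G) :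
    σ.freeAct (y * z) w = σ.freeAct y (σ.freeAct z w) := by
  rw [freeAct, param, map_mul]
  exact torus_mul _ _ w

/-- Composing a representation with a gauge transformation gives a representation. -/
def twist (σ : CircleSymmetry R) (z : Circle) (π : Rep R) : Rep R where
  H := π.H
  op g := π.hom (σ.freeAct z (FreeStarAlg.of g))
  relations r hr := by
    have h : FreeStarAlg.lift (fun g => π.hom (σ.freeAct z (FreeStarAlg.of g))) =
        π.hom.comp (σ.freeAct z) := FreeStarAlg.hom_ext fun g => FreeStarAlg.lift_of _ g
    have hr0 : r ∈ nullIdeal R := by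
      have : supNorm R r ≤ 0 := iSup_le fun ρ => by
        rw [Rep.hom, ρ.relations r hr, enorm_zero]
      exact le_antisymm this (zero_le)
    have h0 : supNorm R (σ.freeAct z r) = 0 := σ.invariant _ (σ.iso z).2 r hr0
    have h1 : ‖π.hom (σ.freeAct z r)‖ₑ ≤ 0 := h0 ▸ enorm_hom_le R π _
    rw [h]
    exact enorm_eq_zero.1 (le_antisymm h1 (zero_le))

theorem twist_hom (σ : CircleSymmetry R) (z : Circle) (π : Rep R)
    (w : FreeStarAlg G) : (σ.twist z π).hom w = π.hom (σ.freeAct z w) := by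
  have h : FreeStarAlg.lift (fun g => π.hom (σ.freeAct z (FreeStarAlg.of g))) =
    π.hom.comp (σ.freeAct z) := FreeStarAlg.hom_ext fun g => FreeStarAlg.lift_of _ g
  exact DFunLike.congr_fun h w

theorem supNorm_freeAct_le (σ : CircleSymmetry R) (z : Circle)
    (w : FreeStarAlg G) : supNorm R (σ.freeAct z w) ≤ supNorm R w :=
  iSup_le fun π => by
    rw [← σ.twist_hom z π w]
    exact enorm_hom_le R _ w

/-- The `*`-endomorphism of `C*(G, R)` induced by a gauge transformation. -/
def gaugeHom (σ : CircleSymmetry R) (hR : Admissible R) (z : Circle) :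
    Univ R hR →⋆ₙₐ[ℂ] Univ R hR :=
  Univ.extend ((Univ.mk R hR).comp (σ.freeAct z)) fun w => by
    change ‖Univ.mk R hR (σ.freeAct z w)‖ ≤ _
    rw [Univ.norm_mk]
    exact ENNReal.toReal_mono (hR w).ne (σ.supNorm_freeAct_le z w)

theorem gaugeHom_mk (σ : CircleSymmetry R) (hR : Admissible R) (z : Circle) (w : FreeStarAlg G) :
    σ.gaugeHom hR z (Univ.mk R hR w) = Univ.mk R hR (σ.freeAct z w) :=
  Univ.extend_mk _ _ w

theorem continuous_gaugeHom (σ : CircleSymmetry R) (hR : Admissible R) (z : Circle) :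
    Continuous (σ.gaugeHom hR z) := Univ.continuous_extend _ _

theorem gaugeHom_one (σ : CircleSymmetry R) (hR : Admissible R) (a : Univ R hR) :
    σ.gaugeHom hR 1 a = a := by
  induction a using Univ.induction with
  | hp => exact isClosed_eq (σ.continuous_gaugeHom hR 1) continuous_id
  | ih w => exact (σ.gaugeHom_mk hR 1 w).trans (congrArg _ (σ.freeAct_one w))

theorem gaugeHom_mul (σ : CircleSymmetry R) (hR : Admissible R) (y z : Circle) (a : Univ R hR) :
    σ.gaugeHom hR (y * z) a = σ.gaugeHom hR y (σ.gaugeHom hR z a) := by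
  induction a using Univ.induction with
  | hp =>
    exact isClosed_eq (σ.continuous_gaugeHom hR _)
      ((σ.continuous_gaugeHom hR y).comp (σ.continuous_gaugeHom hR z))
  | ih w => rw [gaugeHom_mk, gaugeHom_mk, gaugeHom_mk, freeAct_mul]

/-- A gauge transformation as a `*`-automorphism of `C*(G, R)`. -/
def gaugeAut (σ : CircleSymmetry R) (hR : Admissible R) (z : Circle) :
    Univ R hR ≃⋆ₐ[ℂ] Univ R hR where
  toFun := σ.gaugeHom hR z
  invFun := σ.gaugeHom hR z⁻¹
  left_inv a := by rw [← gaugeHom_mul, inv_mul_cancel, gaugeHom_one]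
  right_inv a := by rw [← gaugeHom_mul, mul_inv_cancel, gaugeHom_one]
  map_mul' := map_mul _
  map_add' := map_add _
  map_star' := map_star _
  map_smul' := map_smul _

theorem norm_gaugeHom_le (σ : CircleSymmetry R) (hR : Admissible R) (z : Circle)
    (a : Univ R hR) : ‖σ.gaugeHom hR z a‖ ≤ ‖a‖ := by
  induction a using Univ.induction with
  | hp =>
    exact isClosed_le (continuous_norm.comp (σ.continuous_gaugeHom hR z)) continuous_norm
  | ih w =>
    rw [gaugeHom_mk, Univ.norm_mk, Univ.norm_mk]
    exact ENNReal.toReal_mono (hR w).ne (σ.supNorm_freeAct_le z w)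

theorem continuous_mk_freeAct (σ : CircleSymmetry R) (hR : Admissible R) (w : FreeStarAlg G) :
    Continuous fun z => Univ.mk R hR (σ.freeAct z w) := by
  induction w using FreeStarAlg.induction_of with
  | of g =>
    have h : ∀ z, Univ.mk R hR (σ.freeAct z (FreeStarAlg.of g)) =
        ((σ.param z g : Circle) : ℂ) • Univ.mk R hR (FreeStarAlg.of g) := fun z => by
      rw [freeAct, torus, FreeStarAlg.lift_of, map_smul]
    have hc : Continuous fun z => σ.param z g :=
      (continuous_apply g).comp (continuous_subtype_val.comp σ.iso.continuous)
    simp only [h]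
    exact (continuous_subtype_val.comp hc).smul continuous_const
  | star x hx => simp only [map_star]; fun_prop
  | add x y hx hy => simp only [map_add]; fun_prop
  | mul x y hx hy => simp only [map_mul]; fun_prop
  | smul c x hx => simp only [map_smul]; exact hx.const_smul c
  | zero => simp only [map_zero]; fun_prop

theorem continuous_gaugeHom_orbit (σ : CircleSymmetry R) (hR : Admissible R) (a : Univ R hR) :
    Continuous fun z => σ.gaugeHom hR z a := by
  rw [Metric.continuous_iff']
  intro z ε hε
  obtain ⟨w, hw⟩ := Metric.denseRange_iff.1 (Univ.denseRange_mk (R := R) (hR := hR)) a (ε / 3)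
    (by positivity)
  have hz := Metric.continuous_iff'.1 (σ.continuous_mk_freeAct hR w) z (ε / 3) (by positivity)
  filter_upwards [hz] with y hy
  have key : ∀ x, dist (σ.gaugeHom hR x a) (Univ.mk R hR (σ.freeAct x w)) < ε / 3 := fun x => by
    rw [← gaugeHom_mk, dist_eq_norm, ← map_sub]
    exact (σ.norm_gaugeHom_le hR x _).trans_lt (by rwa [← dist_eq_norm])
  have h1 := dist_triangle4_right (σ.gaugeHom hR y a) (σ.gaugeHom hR z a)
    (Univ.mk R hR (σ.freeAct y w)) (Univ.mk R hR (σ.freeAct z w))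
  linarith [key y, key z]

/-- The circle gauge action `γ` on `C*(G, R)`. -/
def gauge (σ : CircleSymmetry R) (hR : Admissible R) : CircleAction (Univ R hR) where
  aut :=
    { toFun := σ.gaugeAut hR
      map_one' := StarAlgEquiv.ext fun a => σ.gaugeHom_one hR a
      map_mul' := fun y z => StarAlgEquiv.ext fun a => σ.gaugeHom_mul hR y z a }
  continuous_orbit := σ.continuous_gaugeHom_orbit hR

end CircleSymmetry

/-- The fixed-point algebra of a circle action. -/
def CircleAction.fixed {A : Type*} [NonUnitalCStarAlgebra A] (γ : CircleAction A) :
    NonUnitalStarSubalgebra ℂ A where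
  carrier := {a | ∀ z, γ.aut z a = a}
  add_mem' ha hb z := by rw [map_add, ha z, hb z]
  zero_mem' z := map_zero _
  mul_mem' ha hb z := by rw [map_mul, ha z, hb z]
  smul_mem' c a ha z := by rw [map_smul, ha z]
  star_mem' ha z := by rw [map_star, ha z]

end UniversalCStar

end

/-!
A representation `π` of `C*(G, R)` that intertwines the gauge action `γ` with a circle action on
`C*(π)` has a gauge-invariant kernel. Averaging over the circle with respect to Haar measure,
`E(a) = ∫ γ_z(a) dz`, maps `C*(G, R)` to the fixed-point algebra and the kernel of `π` to itself.
So if `π` is injective on the fixed-point algebra and `π(a) = 0`, then `E(a⋆ a) = 0`; evaluating in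
an arbitrary representation at a vector shows that `a = 0`, because a continuous nonnegative
function on the circle with integral `0` vanishes (`injective_of_injOn_fixed`). Conversely, an
injective `π` is an isomorphism of `C*(G, R)` onto `C*(π)`, along which `γ` is transported
(`exists_circleAction_of_injective`). So injectivity on the fixed-point algebra implies the
characterization of injectivity by circle actions.

For the converse implication, a faithful representation `π` is replaced by the direct sum of all
`π ∘ γ_z` on `ℓ²(𝕋, H)`, with `𝕋` regarded as a discrete set (`orbitSum`). It is again faithful, and the
translations of `𝕋` are unitaries that implement `γ` on it. They need not be continuous in the
parameter, but the resulting automorphisms of the generated `C*`-algebra have continuous orbits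
since `γ` has (`exists_circleAction_orbitSum`). Hence the assumed characterization makes the direct
sum injective on `C*(G, R)`. On a fixed element all of its summands agree with `π`, so `π`
is injective on the fixed-point algebra.
-/

noncomputable section

namespace UniversalCStar

open MeasureTheory

universe u

/-! ### Homomorphisms on the universal algebra -/

section Univ

variable {G : Type u} {R : Set (FreeStarAlg G)} {hR : Admissible R}

theorem continuous_starHom {A B : Type*} [NonUnitalCStarAlgebra A] [NonUnitalCStarAlgebra B]
    (φ : A →⋆ₙₐ[ℂ] B) : Continuous φ :=
  (AddMonoidHomClass.lipschitz_of_bound φ 1 fun a => by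
    rw [one_mul]; exact NonUnitalStarAlgHom.norm_apply_le φ a).continuous

theorem Univ.hom_ext {B : Type*} [NonUnitalCStarAlgebra B] {φ ψ : Univ R hR →⋆ₙₐ[ℂ] B}
    (h : ∀ g, φ (Univ.mk R hR (FreeStarAlg.of g)) = ψ (Univ.mk R hR (FreeStarAlg.of g))) :
    φ = ψ := by
  have hfree : φ.comp (Univ.mk R hR) = ψ.comp (Univ.mk R hR) := FreeStarAlg.hom_ext h
  ext a
  induction a using Univ.induction with
  | hp => exact isClosed_eq (continuous_starHom φ) (continuous_starHom ψ)
  | ih w => exact DFunLike.congr_fun hfree w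

theorem Rep.continuous_extend (π : Rep R) : Continuous (π.extend hR) :=
  Univ.continuous_extend _ _

theorem Univ.norm_le_of_forall_rep {C : ℝ} (hC : 0 ≤ C) (a : Univ R hR)
    (h : ∀ π : Rep R, ‖π.extend hR a‖ ≤ C) : ‖a‖ ≤ C := by
  refine le_of_forall_pos_le_add fun ε hε => ?_
  obtain ⟨w, hw⟩ := Metric.denseRange_iff.1 (Univ.denseRange_mk (R := R) (hR := hR)) a (ε / 2)
    (by positivity)
  rw [dist_eq_norm] at hw
  have hmk : ‖Univ.mk R hR w‖ ≤ C + ε / 2 := by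
    rw [Univ.norm_mk]
    refine ENNReal.toReal_le_of_le_ofReal (by positivity) (iSup_le fun π => ?_)
    rw [← ofReal_norm]
    refine ENNReal.ofReal_le_ofReal ?_
    have h1 : ‖π.extend hR (a - Univ.mk R hR w)‖ ≤ ‖a - Univ.mk R hR w‖ :=
      NonUnitalStarAlgHom.norm_apply_le _ _
    rw [map_sub, Rep.extend_mk] at h1
    have h2 := norm_sub_norm_le (π.hom w) (π.extend hR a)
    rw [norm_sub_rev] at h2
    linarith [h π]
  have h3 := norm_sub_norm_le a (Univ.mk R hR w)
  linarith

/-- The representations of `(G, R)` separate the points of `C*(G, R)`. -/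
theorem Univ.eq_zero_of_forall_rep (a : Univ R hR) (h : ∀ π : Rep R, π.extend hR a = 0) :
    a = 0 :=
  norm_le_zero_iff.1 (Univ.norm_le_of_forall_rep le_rfl a fun π => by rw [h π, norm_zero])

/-- The representation of `(G, R)` underlying a representation of `C*(G, R)`. -/
def Rep.ofUniv {H : Type u} [NormedAddCommGroup H] [InnerProductSpace ℂ H] [CompleteSpace H]
    (φ : Univ R hR →⋆ₙₐ[ℂ] (H →L[ℂ] H)) : Rep R where
  H := H
  op g := φ (Univ.mk R hR (FreeStarAlg.of g))
  relations r hr := by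
    have h : FreeStarAlg.lift (fun g => φ (Univ.mk R hR (FreeStarAlg.of g))) =
        φ.comp (Univ.mk R hR) := FreeStarAlg.hom_ext fun g => FreeStarAlg.lift_of _ g
    have hr0 : r ∈ nullIdeal R := le_antisymm (iSup_le fun ρ => by
      rw [Rep.hom, ρ.relations r hr, enorm_zero]) zero_le
    rw [h, NonUnitalStarAlgHom.comp_apply, (Univ.mk_eq_zero_iff r).2 hr0, map_zero]

theorem Rep.extend_ofUniv {H : Type u} [NormedAddCommGroup H] [InnerProductSpace ℂ H]
    [CompleteSpace H] (φ : Univ R hR →⋆ₙₐ[ℂ] (H →L[ℂ] H)) : (Rep.ofUniv φ).extend hR = φ :=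
  Univ.hom_ext fun g => (Rep.extend_mk _ hR _).trans (FreeStarAlg.lift_of _ g)

end Univ

/-! ### The `C*`-algebra generated by a representation -/

section cstar

variable {G : Type u} {R : Set (FreeStarAlg G)} (π : Rep R) (hR : Admissible R)

/-- Used as a local instance to regard `C*(π)` as a `C*`-algebra in its own right. -/
theorem Rep.isClosed_cstar : IsClosed (π.cstar : Set (π.H →L[ℂ] π.H)) :=
  NonUnitalStarSubalgebra.isClosed_topologicalClosure _

theorem Rep.hom_mem_cstar (w : FreeStarAlg G) : π.hom w ∈ π.cstar := by
  induction w using FreeStarAlg.induction_of with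
  | of g => rw [Rep.hom, FreeStarAlg.lift_of]; exact π.op_mem_cstar g
  | star x hx => rw [map_star]; exact star_mem hx
  | add x y hx hy => rw [map_add]; exact add_mem hx hy
  | mul x y hx hy => rw [map_mul]; exact mul_mem hx hy
  | smul c x hx => rw [map_smul]; exact SMulMemClass.smul_mem c hx
  | zero => rw [map_zero]; exact zero_mem _

theorem Rep.cstar_subset_closure_range :
    (π.cstar : Set (π.H →L[ℂ] π.H)) ⊆ closure (Set.range π.hom) := by
  have h : NonUnitalStarAlgebra.adjoin ℂ (Set.range π.op) ≤ NonUnitalStarAlgHom.range π.hom := by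
    refine NonUnitalStarAlgebra.adjoin_le ?_
    rintro _ ⟨g, rfl⟩
    exact ⟨FreeStarAlg.of g, FreeStarAlg.lift_of _ g⟩
  exact closure_mono h

theorem Rep.extend_mem_cstar (a : Univ R hR) : π.extend hR a ∈ π.cstar := by
  induction a using Univ.induction with
  | hp => exact π.isClosed_cstar.preimage π.continuous_extend
  | ih w => rw [Rep.extend_mk]; exact π.hom_mem_cstar w

/-- The extension of a representation to `C*(G, R)`, with values in the generated
`C*`-algebra. -/
def Rep.toCstar : Univ R hR →⋆ₙₐ[ℂ] π.cstar :=
  NonUnitalStarAlgHom.codRestrict (π.extend hR) π.cstar (π.extend_mem_cstar hR)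

theorem Rep.toCstar_mk_of (g : G) :
    π.toCstar hR (Univ.mk R hR (FreeStarAlg.of g)) = π.gen g :=
  Subtype.ext ((π.extend_mk hR _).trans (FreeStarAlg.lift_of _ g))

theorem Rep.denseRange_toCstar : DenseRange (π.toCstar hR) := by
  intro x
  rw [closure_subtype]
  refine closure_mono ?_ (π.cstar_subset_closure_range x.2)
  rintro _ ⟨w, rfl⟩
  exact ⟨_, ⟨Univ.mk R hR w, rfl⟩, π.extend_mk hR w⟩

/-- An injective homomorphism of `C*`-algebras is isometric, so its range is closed. -/
theorem Rep.bijective_toCstar (h : Function.Injective (π.extend hR)) :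
    Function.Bijective (π.toCstar hR) := by
  have := π.isClosed_cstar
  have hinj : Function.Injective (π.toCstar hR) := fun a b hab => h (congrArg Subtype.val hab)
  refine ⟨hinj, ?_⟩
  have hclosed :=
    (NonUnitalStarAlgHom.isometry (π.toCstar hR) hinj).isClosedEmbedding.isClosed_range
  rw [← Set.range_eq_univ, ← hclosed.closure_eq]
  exact (π.denseRange_toCstar hR).closure_range

end cstar

/-! ### Averaging over the circle -/

namespace CircleAction

/-- The Borel `σ`-algebra, which carries the Haar measure used for averaging. -/
instance : MeasurableSpace Circle := borel Circle

instance : BorelSpace Circle := ⟨rfl⟩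

variable {A : Type*} [NonUnitalCStarAlgebra A] (γ : CircleAction A)

theorem integrable_orbit (a : A) : Integrable (fun z => γ.aut z a) Measure.haar :=
  (γ.continuous_orbit a).integrable_of_hasCompactSupport (HasCompactSupport.of_compactSpace _)

/-- The average of `a` over its orbit, with respect to Haar measure on the circle. -/
def mean (a : A) : A := ∫ z, γ.aut z a ∂Measure.haar

theorem map_mean {E : Type*} [NormedAddCommGroup E] [NormedSpace ℂ E] [CompleteSpace E]
    (L : A →L[ℂ] E) (a : A) : L (γ.mean a) = ∫ z, L (γ.aut z a) ∂Measure.haar :=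
  (L.integral_comp_comm (γ.integrable_orbit a)).symm

theorem mean_mem_fixed (a : A) : γ.mean a ∈ γ.fixed := fun y => by
  have hc : Continuous (γ.aut y : A → A) :=
    continuous_starHom ((γ.aut y : A ≃⋆ₐ[ℂ] A) : A →⋆ₙₐ[ℂ] A)
  let L : A →L[ℂ] A :=
    { toFun := γ.aut y, map_add' := map_add _, map_smul' := map_smul _, cont := hc }
  change L (γ.mean a) = _
  rw [map_mean]
  have h : ∀ z, L (γ.aut z a) = γ.aut (y * z) a := fun z => by rw [map_mul]; rfl
  simp_rw [h]
  exact integral_mul_left_eq_self (μ := Measure.haar) (fun z => γ.aut z a) y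

/-- Averaging is faithful, in the form seen by a representation: if the average of `a⋆ a` is `0`,
then `∫ ‖φ (γ_z a) ξ‖² dz = 0` for every vector `ξ`, and the integrand, being continuous and
nonnegative, vanishes at `z = 1`. -/
theorem apply_eq_zero_of_mean_eq_zero {H : Type*} [NormedAddCommGroup H]
    [InnerProductSpace ℂ H] [CompleteSpace H] (φ : A →⋆ₙₐ[ℂ] (H →L[ℂ] H)) {a : A}
    (ha : γ.mean (star a * a) = 0) : φ a = 0 := by
  ext ξ
  let L : A →L[ℂ] ℂ :=
    { toFun := fun b => inner ℂ ξ (φ b ξ)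
      map_add' := fun b c => by simp
      map_smul' := fun c b => by simp
      cont := continuous_const.inner ((continuous_starHom φ).clm_apply continuous_const) }
  have hL : ∀ z, L (γ.aut z (star a * a)) = ((‖φ (γ.aut z a) ξ‖ ^ 2 : ℝ) : ℂ) := fun z => by
    change inner ℂ ξ (φ (γ.aut z (star a * a)) ξ) = _
    rw [map_mul, map_star, map_mul, map_star, mul_apply_eq_comp,
      ContinuousLinearMap.star_eq_adjoint, ContinuousLinearMap.adjoint_inner_right,
      inner_self_eq_norm_sq_to_K]
    norm_cast
  have hint : ∫ z, ‖φ (γ.aut z a) ξ‖ ^ 2 ∂(Measure.haar : Measure Circle) = 0 := by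
    have h := γ.map_mean L (star a * a)
    simp_rw [ha, map_zero, hL] at h
    rw [integral_complex_ofReal] at h
    exact_mod_cast h.symm
  have hc : Continuous fun z => ‖φ (γ.aut z a) ξ‖ ^ 2 :=
    (((continuous_starHom φ).comp (γ.continuous_orbit a)).clm_apply continuous_const).norm.pow 2
  by_contra hne
  refine (hc.integral_pos_of_hasCompactSupport_nonneg_nonzero (x := 1)
    (HasCompactSupport.of_compactSpace _) (fun z => sq_nonneg _) ?_).ne' hint
  simpa using hne

/-- A homomorphism whose kernel is invariant under a circle action sends the average of an element
of the kernel to `0`. -/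
theorem map_mean_eq_zero {B : Type*} [NonUnitalCStarAlgebra B] (φ : A →⋆ₙₐ[ℂ] B) {a : A}
    (h : ∀ z, φ (γ.aut z a) = 0) : φ (γ.mean a) = 0 := by
  let L : A →L[ℂ] B :=
    { toFun := φ, map_add' := map_add _, map_smul' := map_smul _, cont := continuous_starHom φ }
  change L (γ.mean a) = 0
  rw [map_mean]
  simp [L, h]

end CircleAction

/-! ### Direct sums of representations on `ℓ²` -/

section directSum

variable {ι : Type*} {H : Type*} [NormedAddCommGroup H] [InnerProductSpace ℂ H]

/-- The diagonal operator on `ℓ²(ι, H)` given by a family of operators on `H` that is bounded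
by `C`. -/
def diagonal (T : ι → H →L[ℂ] H) (C : ℝ) (hT : ∀ i, ‖T i‖ ≤ C) :
    lp (fun _ : ι => H) 2 →L[ℂ] lp (fun _ : ι => H) 2 :=
  have hb : ∀ (f : lp (fun _ : ι => H) 2) (i : ι), ‖T i (f i)‖ ≤ ‖((C : ℂ) • f) i‖ := fun f i => by
    rw [lp.coeFn_smul, Pi.smul_apply, norm_smul, Complex.norm_real]
    refine (T i).le_of_opNorm_le ((hT i).trans (le_abs_self C)) _
  LinearMap.mkContinuous
    { toFun := fun f => ⟨fun i => T i (f i), (lp.memℓp ((C : ℂ) • f)).norm.mono (hb f)⟩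
      map_add' := fun f g => by ext i; exact map_add (T i) _ _
      map_smul' := fun c f => by ext i; exact map_smul (T i) _ _ } |C| fun f => by
    refine (lp.norm_mono two_ne_zero (hb f)).trans (le_of_eq ?_)
    rw [norm_smul, Complex.norm_real, Real.norm_eq_abs]

theorem diagonal_apply (T : ι → H →L[ℂ] H) (C : ℝ) (hT : ∀ i, ‖T i‖ ≤ C)
    (f : lp (fun _ : ι => H) 2) (i : ι) : diagonal T C hT f i = T i (f i) := rfl

variable [CompleteSpace H] {A : Type*} [NonUnitalCStarAlgebra A]

/-- The direct sum, on `ℓ²(ι, H)`, of a family of representations of a `C*`-algebra on `H`. -/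
def directSum (φ : ι → A →⋆ₙₐ[ℂ] (H →L[ℂ] H)) :
    A →⋆ₙₐ[ℂ] (lp (fun _ : ι => H) 2 →L[ℂ] lp (fun _ : ι => H) 2) where
  toFun a := diagonal (fun i => φ i a) ‖a‖ fun i => NonUnitalStarAlgHom.norm_apply_le (φ i) a
  map_smul' c a := by ext f i; simp [diagonal_apply]
  map_zero' := by ext f i; simp [diagonal_apply]
  map_add' a b := by ext f i; simp [diagonal_apply]
  map_mul' a b := by ext f i; simp [diagonal_apply]
  map_star' a := by
    rw [ContinuousLinearMap.star_eq_adjoint, ContinuousLinearMap.eq_adjoint_iff]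
    intro f g
    rw [lp.inner_eq_tsum, lp.inner_eq_tsum]
    refine tsum_congr fun i => ?_
    change inner ℂ (φ i (star a) (f i)) (g i) = inner ℂ (f i) (φ i a (g i))
    rw [map_star, ContinuousLinearMap.star_eq_adjoint, ContinuousLinearMap.adjoint_inner_left]

theorem directSum_apply (φ : ι → A →⋆ₙₐ[ℂ] (H →L[ℂ] H)) (a : A)
    (f : lp (fun _ : ι => H) 2) (i : ι) : directSum φ a f i = φ i a (f i) := rfl

theorem directSum_eq_zero_iff (φ : ι → A →⋆ₙₐ[ℂ] (H →L[ℂ] H)) (a : A) :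
    directSum φ a = 0 ↔ ∀ i, φ i a = 0 := by
  classical
  refine ⟨fun h i => ?_, fun h => ?_⟩
  · ext ξ
    have := congrArg (fun f : lp (fun _ : ι => H) 2 => f i)
      (DFunLike.congr_fun h (lp.single 2 i ξ))
    simpa [directSum_apply] using this
  · ext f i
    simp [directSum_apply, h]

variable (H) in
/-- The unitary on `ℓ²(ι, H)` that permutes the coordinates: the `i`-th coordinate of the
image of `f` is `f (e i)`. -/
def permute (e : ι ≃ ι) : lp (fun _ : ι => H) 2 ≃ₗᵢ[ℂ] lp (fun _ : ι => H) 2 where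
  toFun f := ⟨fun i => f (e i), memℓp_gen
    ((e.summable_iff (f := fun i => ‖f i‖ ^ (2 : ℝ≥0∞).toReal)).2
      ((lp.memℓp f).summable (by norm_num)))⟩
  invFun f := ⟨fun i => f (e.symm i), memℓp_gen
    ((e.symm.summable_iff (f := fun i => ‖f i‖ ^ (2 : ℝ≥0∞).toReal)).2
      ((lp.memℓp f).summable (by norm_num)))⟩
  map_add' f g := rfl
  map_smul' c f := rfl
  left_inv f := by ext i; exact congrArg f (e.apply_symm_apply i)
  right_inv f := by ext i; exact congrArg f (e.symm_apply_apply i)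
  norm_map' f := by
    rw [lp.norm_eq_tsum_rpow (by norm_num), lp.norm_eq_tsum_rpow (by norm_num)]
    congr 1
    exact e.tsum_eq fun i => ‖f i‖ ^ (2 : ℝ≥0∞).toReal

end directSum

/-! ### Gauge actions on generated `C*`-algebras -/

section gauge

variable {G : Type u} {R : Set (FreeStarAlg G)} (σ : CircleSymmetry R) (hR : Admissible R)

theorem gauge_aut_mk (z : Circle) (w : FreeStarAlg G) :
    (σ.gauge hR).aut z (Univ.mk R hR w) = Univ.mk R hR (σ.freeAct z w) :=
  σ.gaugeHom_mk hR z w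

/-- A circle action on `C*(π)` that is given by `γ` on the generators is intertwined with the gauge
action on `C*(G, R)`. -/
theorem aut_toCstar (π : Rep R) (β : CircleAction π.cstar)
    (hβ : ∀ (z : Circle) (g : G),
      (β.aut z (π.gen g) : π.H →L[ℂ] π.H) = π.hom (σ.freeAct z (FreeStarAlg.of g)))
    (z : Circle) (a : Univ R hR) :
    β.aut z (π.toCstar hR a) = π.toCstar hR ((σ.gauge hR).aut z a) := by
  have := π.isClosed_cstar
  have h : ((β.aut z : π.cstar ≃⋆ₐ[ℂ] π.cstar) : π.cstar →⋆ₙₐ[ℂ] π.cstar).comp (π.toCstar hR) =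
      (π.toCstar hR).comp (((σ.gauge hR).aut z : Univ R hR ≃⋆ₐ[ℂ] Univ R hR) :
        Univ R hR →⋆ₙₐ[ℂ] Univ R hR) := by
    refine Univ.hom_ext fun g => Subtype.ext ?_
    change (β.aut z (π.toCstar hR (Univ.mk R hR (FreeStarAlg.of g))) : π.H →L[ℂ] π.H) =
      π.extend hR ((σ.gauge hR).aut z (Univ.mk R hR (FreeStarAlg.of g)))
    rw [π.toCstar_mk_of, hβ, gauge_aut_mk, π.extend_mk]
  exact DFunLike.congr_fun h a

/-- If `C*(G, R) → L(H)` is injective on the fixed-point algebra and has a gauge-invariant kernel,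
then it is injective: for `a` in the kernel, the average of `a⋆ a` lies in the kernel and is fixed,
hence it is `0`. -/
theorem injective_of_injOn_fixed (π : Rep R)
    (hfix : Set.InjOn (π.extend hR) (σ.gauge hR).fixed)
    (hker : ∀ z a, π.extend hR a = 0 → π.extend hR ((σ.gauge hR).aut z a) = 0) :
    Function.Injective (π.extend hR) := by
  rw [injective_iff_map_eq_zero]
  intro a ha
  have hmean : (σ.gauge hR).mean (star a * a) = 0 := by
    refine hfix ((σ.gauge hR).mean_mem_fixed _) (zero_mem _) ?_
    rw [map_zero]
    exact (σ.gauge hR).map_mean_eq_zero _ fun z => by rw [map_mul, map_mul, hker z a ha, mul_zero]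
  exact Univ.eq_zero_of_forall_rep a fun ρ =>
    (σ.gauge hR).apply_eq_zero_of_mean_eq_zero (ρ.extend hR) hmean

/-- The gauge action, transported to `C*(π)` along the isomorphism `C*(G, R) ≅ C*(π)` induced by a
representation that is injective on `C*(G, R)`. -/
theorem exists_circleAction_of_injective (π : Rep R) (h : Function.Injective (π.extend hR)) :
    ∃ β : CircleAction π.cstar, ∀ (z : Circle) (g : G),
      (β.aut z (π.gen g) : π.H →L[ℂ] π.H) = π.hom (σ.freeAct z (FreeStarAlg.of g)) := by
  have hcont : Continuous (π.toCstar hR) := π.continuous_extend.subtype_mk _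
  let e : Univ R hR ≃⋆ₐ[ℂ] π.cstar := StarAlgEquiv.ofBijective _ (π.bijective_toCstar hR h)
  refine ⟨{ aut :=
              { toFun := fun z => (e.symm.trans ((σ.gauge hR).aut z)).trans e
                map_one' := ?_
                map_mul' := fun y z => ?_ }
            continuous_orbit := fun x => ?_ }, fun z g => ?_⟩
  · ext1 x
    change e ((σ.gauge hR).aut 1 (e.symm x)) = x
    rw [map_one]
    exact e.apply_symm_apply x
  · ext1 x
    change e ((σ.gauge hR).aut (y * z) (e.symm x)) =
      e ((σ.gauge hR).aut y (e.symm (e ((σ.gauge hR).aut z (e.symm x)))))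
    rw [e.symm_apply_apply, map_mul]
    rfl
  · exact hcont.comp ((σ.gauge hR).continuous_orbit (e.symm x))
  · have hg : e.symm (π.gen g) = Univ.mk R hR (FreeStarAlg.of g) := by
      rw [← π.toCstar_mk_of hR]
      exact e.symm_apply_apply _
    change π.extend hR ((σ.gauge hR).aut z (e.symm (π.gen g))) = _
    rw [hg, gauge_aut_mk, π.extend_mk]

/-- A unitary group that implements the gauge action on a representation induces a circle action on
the generated `C*`-algebra. The unitaries need not depend continuously on the parameter: the orbit
maps are continuous on the image of the free algebra, and the general case follows by
approximation. -/
theorem exists_circleAction_of_unitary (hR : Admissible R) (π : Rep R)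
    (U : Circle → π.H ≃ₗᵢ[ℂ] π.H)
    (hU : ∀ z w, (U z).conjStarAlgEquiv (π.hom w) = π.hom (σ.freeAct z w)) :
    ∃ β : CircleAction π.cstar, ∀ (z : Circle) (g : G),
      (β.aut z (π.gen g) : π.H →L[ℂ] π.H) = π.hom (σ.freeAct z (FreeStarAlg.of g)) := by
  let α : Circle → (π.H →L[ℂ] π.H) ≃⋆ₐ[ℂ] (π.H →L[ℂ] π.H) := fun z => (U z).conjStarAlgEquiv
  have hα : ∀ z w, α z (π.hom w) = π.hom (σ.freeAct z w) := hU
  have hnorm : ∀ z x, ‖α z x‖ ≤ ‖x‖ := fun z x => NonUnitalStarAlgHom.norm_apply_le (α z) x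
  have hcont : ∀ z, Continuous (α z) := fun z =>
    (AddMonoidHomClass.lipschitz_of_bound (α z) 1 fun x => by
      rw [one_mul]; exact hnorm z x).continuous
  -- A closed condition on `C*(π)` may be checked on the image of the free algebra.
  have hind : ∀ {p : (π.H →L[ℂ] π.H) → Prop}, IsClosed {x | p x} → (∀ w, p (π.hom w)) →
      ∀ x : π.cstar, p x := fun hp hw x =>
    hp.closure_subset_iff.2 (by rintro _ ⟨w, rfl⟩; exact hw w) (π.cstar_subset_closure_range x.2)
  have hmem : ∀ z (x : π.cstar), α z x ∈ π.cstar := fun z =>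
    hind (p := fun x => α z x ∈ π.cstar) (π.isClosed_cstar.preimage (hcont z)) fun w => by
      rw [hα]; exact π.hom_mem_cstar _
  have hone : ∀ x : π.cstar, α 1 x = x :=
    hind (p := fun x => α 1 x = x) (isClosed_eq (hcont 1) continuous_id) fun w => by
      rw [hα, σ.freeAct_one]
  have hmul : ∀ y z (x : π.cstar), α (y * z) x = α y (α z x) := fun y z =>
    hind (p := fun x => α (y * z) x = α y (α z x))
      (isClosed_eq (hcont _) ((hcont y).comp (hcont z))) fun w => by
      rw [hα, hα, hα, σ.freeAct_mul]
  have horbit : ∀ x : π.cstar, Continuous fun z => α z x := fun x => by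
    refine continuous_of_uniform_approx_of_continuous fun u hu => ?_
    obtain ⟨ε, hε, hεu⟩ := Metric.mem_uniformity_dist.1 hu
    obtain ⟨_, ⟨w, rfl⟩, hw⟩ := Metric.mem_closure_iff.1 (π.cstar_subset_closure_range x.2) ε hε
    refine ⟨fun z => α z (π.hom w), ?_, fun z => hεu ?_⟩
    · simp_rw [hα, ← π.extend_mk hR]
      exact π.continuous_extend.comp (σ.continuous_mk_freeAct hR w)
    · rw [dist_eq_norm, ← map_sub]
      exact (hnorm z _).trans_lt (by rwa [← dist_eq_norm])
  let β : Circle → π.cstar ≃⋆ₐ[ℂ] π.cstar := fun z =>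
    { toFun := fun x => ⟨α z x, hmem z x⟩
      invFun := fun x => ⟨α z⁻¹ x, hmem z⁻¹ x⟩
      left_inv := fun x => Subtype.ext ((hmul _ _ _).symm.trans (by rw [inv_mul_cancel, hone]))
      right_inv := fun x => Subtype.ext ((hmul _ _ _).symm.trans (by rw [mul_inv_cancel, hone]))
      map_mul' := fun x y => Subtype.ext (map_mul (α z) _ _)
      map_add' := fun x y => Subtype.ext (map_add (α z) _ _)
      map_star' := fun x => Subtype.ext (map_star (α z) _)
      map_smul' := fun c x => Subtype.ext (map_smul (α z) c _) }
  refine ⟨{ aut :=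
              { toFun := β
                map_one' := StarAlgEquiv.ext fun x => Subtype.ext (hone x)
                map_mul' := fun y z => StarAlgEquiv.ext fun x => Subtype.ext (hmul y z x) }
            continuous_orbit := fun x => (horbit x).subtype_mk _ }, fun z g => ?_⟩
  change α z (π.op g) = _
  rw [← hα, Rep.hom, FreeStarAlg.lift_of]

/-- The direct sum of the representations `π ∘ γ_z`, `z ∈ 𝕋`, of `C*(G, R)` on `ℓ²(𝕋, H)`, with
the circle regarded as a discrete set. -/
def orbitSum (π : Rep R) :
    Univ R hR →⋆ₙₐ[ℂ] (lp (fun _ : Circle => π.H) 2 →L[ℂ] lp (fun _ : Circle => π.H) 2) :=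
  directSum fun z => (π.extend hR).comp (σ.gaugeHom hR z)

theorem orbitSum_eq_zero_iff (π : Rep R) (a : Univ R hR) :
    orbitSum σ hR π a = 0 ↔ ∀ z, π.extend hR ((σ.gauge hR).aut z a) = 0 :=
  directSum_eq_zero_iff _ a

/-- Translation of the circle implements the gauge action on `orbitSum`. -/
theorem conj_permute_orbitSum (π : Rep R) (y : Circle) (a : Univ R hR) :
    (permute π.H (Equiv.mulRight y)).conjStarAlgEquiv (orbitSum σ hR π a) =
      orbitSum σ hR π (σ.gaugeHom hR y a) := by
  ext f z
  change π.extend hR (σ.gaugeHom hR (z * y) a) (f ((Equiv.mulRight y).symm (z * y))) =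
    π.extend hR (σ.gaugeHom hR z (σ.gaugeHom hR y a)) (f z)
  rw [σ.gaugeHom_mul]
  refine congrArg (fun x => π.extend hR (σ.gaugeHom hR z (σ.gaugeHom hR y a)) (f x)) ?_
  exact (Equiv.mulRight y).symm_apply_apply z

theorem isFaithful_orbitSum {π : Rep R} (hπ : π.IsFaithful) :
    (Rep.ofUniv (orbitSum σ hR π)).IsFaithful := fun g h => by
  have h1 := (orbitSum_eq_zero_iff σ hR π _).1 h 1
  rw [map_one] at h1
  refine hπ g ?_
  rw [← FreeStarAlg.lift_of π.op g]
  exact (π.extend_mk hR _).symm.trans h1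

theorem exists_circleAction_orbitSum (π : Rep R) :
    ∃ β : CircleAction (Rep.ofUniv (orbitSum σ hR π)).cstar, ∀ (z : Circle) (g : G),
      (β.aut z ((Rep.ofUniv (orbitSum σ hR π)).gen g) :
        (Rep.ofUniv (orbitSum σ hR π)).H →L[ℂ] (Rep.ofUniv (orbitSum σ hR π)).H) =
      (Rep.ofUniv (orbitSum σ hR π)).hom (σ.freeAct z (FreeStarAlg.of g)) := by
  refine exists_circleAction_of_unitary σ hR (Rep.ofUniv (orbitSum σ hR π))
    (fun y => permute π.H (Equiv.mulRight y)) fun y w => ?_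
  rw [← Rep.extend_mk _ hR, ← Rep.extend_mk _ hR, Rep.extend_ofUniv, ← σ.gaugeHom_mk]
  exact conj_permute_orbitSum σ hR π y _

end gauge

end UniversalCStar

end

theorem mainTheorem3 {G : Type*} (R : Set (UniversalCStar.FreeStarAlg G))
    (hR : UniversalCStar.Admissible R) (hnd : UniversalCStar.Nondegenerate R)
    (σ : UniversalCStar.CircleSymmetry R) :
    (∀ π : UniversalCStar.Rep R, π.IsFaithful →
      Set.InjOn (π.extend hR) (σ.gauge hR).fixed) ↔
    (∀ π : UniversalCStar.Rep R, π.IsFaithful →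
      (Function.Injective (π.extend hR) ↔
        ∃ β : UniversalCStar.CircleAction π.cstar,
          ∀ (z : Circle) (g : G),
            (β.aut z (π.gen g) : π.H →L[ℂ] π.H) =
              π.hom (σ.freeAct z (UniversalCStar.FreeStarAlg.of g)))) := by
  open UniversalCStar in
  constructor
  · intro hfix π hπ
    refine ⟨exists_circleAction_of_injective σ hR π, ?_⟩
    rintro ⟨β, hβ⟩
    refine injective_of_injOn_fixed σ hR π (hfix π hπ) fun z a ha => ?_
    have ha' : π.toCstar hR a = 0 := Subtype.ext ha
    have h := aut_toCstar σ hR π β hβ z a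
    rw [ha', map_zero] at h
    exact congrArg Subtype.val h.symm
  · intro h π hπ a ha b hb hab
    have hinj : Function.Injective (orbitSum σ hR π) := by
      have h' := (h _ (isFaithful_orbitSum σ hR hπ)).2 (exists_circleAction_orbitSum σ hR π)
      rw [Rep.extend_ofUniv] at h'
      exact h'
    -- On the fixed-point algebra all summands of the direct sum agree with `π`.
    refine sub_eq_zero.1 (hinj ?_)
    rw [map_zero, orbitSum_eq_zero_iff]
    intro z
    rw [map_sub, ha z, hb z, map_sub, hab, sub_self]
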